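/- **Halmos' two projections theorem for Hilbert $C^*$-modules.** Let $A$ be a $C^*$-algebra (not necessarily unital), let $H$ be a Hilbert $A$-module, and for Hilbert $A$-modules $E,F$ let $\mathcal L(E,F)$ be the adjointable operators from $E$ to $F$, with $\mathcal L(E)=\mathcal L(E,E)$. For $T\in\mathcal L(E,F)$ let $\mathcal R(T)$ and $\mathcal N(T)$ be its range and null space. A projection is an operator $P\in\mathcal L(H)$ with $P=P^2=P^*$. A closed submodule $M\subseteq H$ is orthogonally complemented if $H=M+M^\perp$; then $P_M$ denotes the projection of $H$ onto $M$. An operator $T\in\mathcal L(E)$ is positive if $\langle Tx,x\rangle\ge 0$ for all $x\in E$, and then $T^{1/2}$ is the unique positive operator with square $T$. Let $P,Q\in\mathcal L(H)$ be two harmonious projections, that is, projections such that the four closures $\overline{\mathcal R(P+Q)}$, $\overline{\mathcal R(P+I-Q)}$, $\overline{\mathcal R(I-P+Q)}$ and $\overline{\mathcal R(2I-P-Q)}$ are all orthogonally complemented in $H$. Put $$H_1=\mathcal R(P)\cap\mathcal R(Q),\quad H_2=\mathcal R(P)\cap\mathcal N(Q),\quad H_3=\mathcal N(P)\cap\mathcal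 R(Q),\quad H_4=\mathcal N(P)\cap\mathcal N(Q).$$ Then $H_1,\dots,H_4$ are orthogonally complemented in $H$. With $P_i=P_{H_i}$ for $1\le i\le 4$, the operators $P_5=P-P_1-P_2$ and $P_6=(I-P)-P_3-P_4$ are projections, and, with $H_5=\mathcal R(P_5)$ and $H_6=\mathcal R(P_6)$, $H$ is the orthogonal direct sum of $H_1,\dots,H_6$. With respect to this decomposition $$P=I_{H_1}\oplus I_{H_2}\oplus 0\oplus 0\oplus I_{H_5}\oplus 0,\qquad Q=I_{H_1}\oplus 0\oplus I_{H_3}\oplus 0\oplus T,$$ where $$T=\begin{pmatrix}P_5QP_5|_{H_5}&P_5QP_6|_{H_6}\\(P_5QP_6|_{H_6})^*&P_6QP_6|_{H_6}\end{pmatrix}\in\mathcal L(H_5\oplus H_6).$$ Let $Q_0=P_5QP_5|_{H_5}\in\mathcal L(H_5)$. Then $Q_0$ and $I_{H_5}-Q_0$ are both positive, injective and contractive, and there is a unitary operator $U_0\in\mathcal L(H_6,H_5)$ such that $$T=\begin{pmatrix}Q_0&Q_0^{1/2}(I_{H_5}-Q_0)^{1/2}U_0\\U_0^*Q_0^{1/2}(I_{H_5}-Q_0)^{1/2}&U_0^*(I_{H_5}-Q_0)U_0\end{pmatrix}.$$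 -/

import Mathlib

open scoped InnerProductSpace WithCStarModule

set_option linter.unusedSectionVars false

namespace HilbertCStar

/-! ### The module action on a Hilbert C⋆-module

`CStarModule A E` only asks for a bare action `SMul A E`; the module axioms follow from the
`A`-valued inner product being nondegenerate. -/

section Action

variable {A E : Type*} [NonUnitalCStarAlgebra A] [PartialOrder A] [StarOrderedRing A]
  [NormedAddCommGroup E] [NormedSpace ℂ E] [SMul A E] [CStarModule A E]

theorem ext_inner {x y : E} (h : ∀ w : E, ⟪w, x⟫_A = ⟪w, y⟫_A) : x = y := by
  rw [← sub_eq_zero, ← CStarModule.inner_self (A := A), CStarModule.inner_sub_right, h, sub_self]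

theorem smul_sub' (a : A) (x y : E) : a • (x - y) = a • x - a • y := by
  refine ext_inner (A := A) fun w => ?_
  simp [mul_sub]

theorem norm_smul_le' (a : A) (x : E) : ‖a • x‖ ≤ ‖a‖ * ‖x‖ := by
  refine le_of_sq_le_sq ?_ (by positivity)
  rw [CStarModule.norm_sq_eq A, CStarModule.inner_op_smul_right, CStarModule.inner_op_smul_left,
    mul_pow, CStarModule.norm_sq_eq A (x := x)]
  calc ‖a * (⟪x, x⟫_A * star a)‖ ≤ ‖a‖ * (‖⟪x, x⟫_A‖ * ‖star a‖) :=
        (norm_mul_le _ _).trans (by gcongr; exact norm_mul_le _ _)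
    _ = ‖a‖ ^ 2 * ‖⟪x, x⟫_A‖ := by rw [norm_star]; ring

theorem continuous_smul' (a : A) : Continuous fun x : E => a • x := by
  refine (LipschitzWith.of_dist_le_mul (K := ‖a‖₊) fun x y => ?_).continuous
  rw [dist_eq_norm, dist_eq_norm, ← smul_sub', coe_nnnorm]
  exact norm_smul_le' a (x - y)

end Action

/-! ### Submodules of a Hilbert C⋆-module -/

/-- An `A`-submodule of a Hilbert C⋆-module: a complex subspace that is stable under `A`
(which need not have a unit). -/
structure CStarSubmodule (A E : Type*) [NonUnitalCStarAlgebra A] [NormedAddCommGroup E]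
    [NormedSpace ℂ E] [SMul A E] extends Submodule ℂ E where
  op_smul_mem' : ∀ (a : A) {x : E}, x ∈ carrier → a • x ∈ carrier

namespace CStarSubmodule

section Basic

variable {A E : Type*} [NonUnitalCStarAlgebra A] [NormedAddCommGroup E]
  [NormedSpace ℂ E] [SMul A E]

instance : SetLike (CStarSubmodule A E) E where
  coe M := M.carrier
  coe_injective M N h := by
    cases M; cases N; congr; exact SetLike.coe_injective h

instance : AddSubgroupClass (CStarSubmodule A E) E where
  add_mem {M} := M.toSubmodule.add_mem
  zero_mem M := M.toSubmodule.zero_mem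
  neg_mem {M} := M.toSubmodule.neg_mem

instance : SMulMemClass (CStarSubmodule A E) ℂ E where
  smul_mem {M} c _ h := M.toSubmodule.smul_mem c h

instance (M : CStarSubmodule A E) : SMul A M where
  smul a x := ⟨a • (x : E), M.op_smul_mem' a x.2⟩

/-- The intersection of two submodules. -/
instance : Min (CStarSubmodule A E) where
  min M N :=
    { toSubmodule := M.toSubmodule ⊓ N.toSubmodule
      op_smul_mem' := fun a _ h => ⟨M.op_smul_mem' a h.1, N.op_smul_mem' a h.2⟩ }

end Basic

section Inner

variable {A E : Type*} [NonUnitalCStarAlgebra A] [PartialOrder A] [StarOrderedRing A]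
  [NormedAddCommGroup E] [NormedSpace ℂ E] [SMul A E] [CStarModule A E]

/-- A submodule inherits the inner product and the norm. -/
instance (M : CStarSubmodule A E) : CStarModule A M where
  inner x y := ⟪(x : E), (y : E)⟫_A
  inner_add_right := CStarModule.inner_add_right (A := A) (E := E)
  inner_self_nonneg := CStarModule.inner_self_nonneg (A := A) (E := E)
  inner_self := (CStarModule.inner_self (A := A) (E := E)).trans ZeroMemClass.coe_eq_zero
  inner_op_smul_right := CStarModule.inner_op_smul_right (A := A) (E := E)
  inner_smul_right_complex := CStarModule.inner_smul_right_complex (A := A) (E := E)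
  star_inner _ _ := CStarModule.star_inner (A := A) (E := E) _ _
  norm_eq_sqrt_norm_inner_self x :=
    CStarModule.norm_eq_sqrt_norm_inner_self (A := A) (E := E) (x : E)

/-- The norm closure `M̄`. -/
def closure (M : CStarSubmodule A E) : CStarSubmodule A E where
  toSubmodule := M.toSubmodule.topologicalClosure
  op_smul_mem' a _ h :=
    map_mem_closure (continuous_smul' a) h fun _ hy => M.op_smul_mem' a hy

/-- The orthogonal complement `M^⊥ = {x | ⟪x, y⟫ = 0 for all y ∈ M}`. -/
def orth (M : CStarSubmodule A E) : CStarSubmodule A E where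
  carrier := {x | ∀ y ∈ M, ⟪x, y⟫_A = 0}
  add_mem' hx hy w hw := by rw [CStarModule.inner_add_left, hx w hw, hy w hw, add_zero]
  zero_mem' _ _ := CStarModule.inner_zero_left
  smul_mem' c x hx w hw := by rw [CStarModule.inner_smul_left_complex, hx w hw, smul_zero]
  op_smul_mem' a x hx w hw := by rw [CStarModule.inner_op_smul_left, hx w hw, zero_mul]

/-- `M` is orthogonally complemented in `E`: `E = M ∔ M^⊥`. -/
def IsOrthComplemented (M : CStarSubmodule A E) : Prop :=
  ∀ x : E, ∃ y ∈ M, ∃ z ∈ M.orth, x = y + z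

/-- `E` is the orthogonal direct sum of the submodules `M i`. -/
def IsOrthogonalDecomposition {n : ℕ} (M : Fin n → CStarSubmodule A E) : Prop :=
  (∀ i j, i ≠ j → ∀ x ∈ M i, ∀ y ∈ M j, ⟪x, y⟫_A = 0) ∧
    ∀ x : E, ∃ f : Fin n → E, (∀ i, f i ∈ M i) ∧ x = ∑ i, f i

end Inner

end CStarSubmodule

/-! ### Adjointable operators -/

/-- The adjointable operators `𝓛(E, F)`: bounded operators `T : E → F` together with their
(unique) adjoint `T* : F → E`, `⟪T x, y⟫ = ⟪x, T* y⟫`. -/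
structure AdjointableMap (A E F : Type*) [NonUnitalCStarAlgebra A] [PartialOrder A]
    [NormedAddCommGroup E] [NormedSpace ℂ E] [SMul A E] [CStarModule A E]
    [NormedAddCommGroup F] [NormedSpace ℂ F] [SMul A F] [CStarModule A F] where
  toCLM : E →L[ℂ] F
  adjCLM : F →L[ℂ] E
  inner_adj : ∀ x y, ⟪toCLM x, y⟫_A = ⟪x, adjCLM y⟫_A

namespace AdjointableMap

variable {A E F G : Type*} [NonUnitalCStarAlgebra A] [PartialOrder A] [StarOrderedRing A]
  [NormedAddCommGroup E] [NormedSpace ℂ E] [SMul A E] [CStarModule A E]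
  [NormedAddCommGroup F] [NormedSpace ℂ F] [SMul A F] [CStarModule A F]
  [NormedAddCommGroup G] [NormedSpace ℂ G] [SMul A G] [CStarModule A G]

instance : CoeFun (AdjointableMap A E F) fun _ => E → F where
  coe T := T.toCLM

theorem inner_adj' (T : AdjointableMap A E F) (x : F) (y : E) :
    ⟪T.adjCLM x, y⟫_A = ⟪x, T y⟫_A := by
  rw [← CStarModule.star_inner y, ← T.inner_adj, CStarModule.star_inner]

/-- An adjointable operator is determined by its underlying map. -/
theorem ext {S T : AdjointableMap A E F} (h : ∀ x, S x = T x) : S = T := by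
  have h1 : S.toCLM = T.toCLM := ContinuousLinearMap.ext h
  have h2 : S.adjCLM = T.adjCLM := by
    refine ContinuousLinearMap.ext fun y => ext_inner (A := A) fun w => ?_
    rw [← S.inner_adj, ← T.inner_adj, h1]
  cases S; cases T; congr

/-- The adjoint `T*`. -/
def adjoint (T : AdjointableMap A E F) : AdjointableMap A F E where
  toCLM := T.adjCLM
  adjCLM := T.toCLM
  inner_adj := T.inner_adj'

/-- The composition `S T`. -/
def comp (S : AdjointableMap A F G) (T : AdjointableMap A E F) : AdjointableMap A E G where
  toCLM := S.toCLM ∘L T.toCLM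
  adjCLM := T.adjCLM ∘L S.adjCLM
  inner_adj x y := by
    simp only [ContinuousLinearMap.comp_apply]
    rw [S.inner_adj, T.inner_adj]

/-- The identity operator. -/
instance : One (AdjointableMap A E E) where
  one := ⟨ContinuousLinearMap.id ℂ E, ContinuousLinearMap.id ℂ E, fun _ _ => rfl⟩

instance : Add (AdjointableMap A E F) where
  add S T := ⟨S.toCLM + T.toCLM, S.adjCLM + T.adjCLM, fun x y => by
    simp only [add_apply, CStarModule.inner_add_left,
      CStarModule.inner_add_right, S.inner_adj, T.inner_adj]⟩

instance : Sub (AdjointableMap A E F) where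
  sub S T := ⟨S.toCLM - T.toCLM, S.adjCLM - T.adjCLM, fun x y => by
    simp only [sub_apply, CStarModule.inner_sub_left,
      CStarModule.inner_sub_right, S.inner_adj, T.inner_adj]⟩

theorem map_op_smul (T : AdjointableMap A E F) (a : A) (x : E) : T (a • x) = a • T x := by
  refine ext_inner (A := A) fun w => ?_
  rw [← T.inner_adj', CStarModule.inner_op_smul_right, CStarModule.inner_op_smul_right, T.inner_adj']

theorem op_smul_zero (a : A) : a • (0 : E) = 0 := by
  refine ext_inner (A := A) fun w => ?_
  rw [CStarModule.inner_op_smul_right, CStarModule.inner_zero_right, mul_zero]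

/-- The range `𝓡(T)`. -/
def range (T : AdjointableMap A E F) : CStarSubmodule A F where
  toSubmodule := LinearMap.range T.toCLM.toLinearMap
  op_smul_mem' := by
    rintro a _ ⟨x, rfl⟩
    exact ⟨a • x, T.map_op_smul a x⟩

/-- The null space `𝓝(T)`. -/
def ker (T : AdjointableMap A E F) : CStarSubmodule A E where
  toSubmodule := LinearMap.ker T.toCLM.toLinearMap
  op_smul_mem' := by
    intro a x (hx : T x = 0)
    change T (a • x) = 0
    rw [T.map_op_smul, hx, op_smul_zero]

/-- A positive operator: `⟪T x, x⟫ ≥ 0` in `A` for all `x`. -/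
def IsPositive (T : AdjointableMap A E E) : Prop :=
  ∀ x, 0 ≤ ⟪T x, x⟫_A

/-- `R = T^{1/2}`: the operator `R` is the unique positive operator whose square is `T`. -/
def IsPositiveSqrt (R T : AdjointableMap A E E) : Prop :=
  R.IsPositive ∧ R.comp R = T ∧ ∀ S : AdjointableMap A E E, S.IsPositive → S.comp S = T → S = R

/-- A unitary operator: `U* U = I` and `U U* = I`. -/
def IsUnitary (U : AdjointableMap A E F) : Prop :=
  U.adjoint.comp U = 1 ∧ U.comp U.adjoint = 1

/-- A projection: `P = P² = P*`. -/
def IsProjection (P : AdjointableMap A E E) : Prop :=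
  P.comp P = P ∧ P.adjoint = P

/-- `P` is the projection `P_M` of `E` onto `M`. -/
def IsProjectionOnto (P : AdjointableMap A E E) (M : CStarSubmodule A E) : Prop :=
  P.IsProjection ∧ P.range = M

/-- Two projections are harmonious if the closures of the ranges of `P + Q`, `P + (I - Q)`,
`(I - P) + Q` and `(I - P) + (I - Q)` are orthogonally complemented. -/
def IsHarmonious (P Q : AdjointableMap A E E) : Prop :=
  P.IsProjection ∧ Q.IsProjection ∧
    (P + Q).range.closure.IsOrthComplemented ∧
    (P + (1 - Q)).range.closure.IsOrthComplemented ∧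
    ((1 - P) + Q).range.closure.IsOrthComplemented ∧
    ((1 - P) + (1 - Q)).range.closure.IsOrthComplemented

/-- For projections `R`, `S` on `E`, the operator `R T S|_{𝓡(S)} : 𝓡(S) → 𝓡(R)`. -/
def compress {R S : AdjointableMap A E E} (hR : R.IsProjection) (hS : S.IsProjection)
    (T : AdjointableMap A E E) : AdjointableMap A S.range R.range where
  toCLM :=
    (R.toCLM ∘L T.toCLM ∘L S.toCLM ∘L S.range.toSubmodule.subtypeL).codRestrict
      R.range.toSubmodule fun x => ⟨T (S (x : E)), rfl⟩
  adjCLM :=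
    (S.toCLM ∘L T.adjCLM ∘L R.toCLM ∘L R.range.toSubmodule.subtypeL).codRestrict
      S.range.toSubmodule fun x => ⟨T.adjCLM (R (x : E)), rfl⟩
  inner_adj x y := by
    change ⟪R (T (S (x : E))), (y : E)⟫_A = ⟪(x : E), S (T.adjCLM (R (y : E)))⟫_A
    have hR' : R.adjCLM = R.toCLM := congrArg toCLM hR.2
    have hS' : S.adjCLM = S.toCLM := congrArg toCLM hS.2
    rw [R.inner_adj, T.inner_adj, S.inner_adj, hR', hS']

/-- The operator matrix `((a, b), (c, d))` acting on the Hilbert module `E ⊕ F`. -/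
noncomputable def block (a : AdjointableMap A E E) (b : AdjointableMap A F E)
    (c : AdjointableMap A E F) (d : AdjointableMap A F F) :
    AdjointableMap A C⋆ᵐᵒᵈ(A, E × F) C⋆ᵐᵒᵈ(A, E × F) where
  toCLM :=
    (WithCStarModule.equivL (A := A) (E := E × F) ℂ).symm.toContinuousLinearMap ∘L
      ((a.toCLM.coprod b.toCLM).prod (c.toCLM.coprod d.toCLM)) ∘L
        (WithCStarModule.equivL (A := A) (E := E × F) ℂ).toContinuousLinearMap
  adjCLM :=
    (WithCStarModule.equivL (A := A) (E := E × F) ℂ).symm.toContinuousLinearMap ∘L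
      ((a.adjCLM.coprod c.adjCLM).prod (b.adjCLM.coprod d.adjCLM)) ∘L
        (WithCStarModule.equivL (A := A) (E := E × F) ℂ).toContinuousLinearMap
  inner_adj x y := by
    change ⟪a x.1 + b x.2, y.1⟫_A + ⟪c x.1 + d x.2, y.2⟫_A =
      ⟪x.1, a.adjCLM y.1 + c.adjCLM y.2⟫_A + ⟪x.2, b.adjCLM y.1 + d.adjCLM y.2⟫_A
    simp only [CStarModule.inner_add_left, CStarModule.inner_add_right, inner_adj]
    abel

end AdjointableMap

end HilbertCStar

open HilbertCStar HilbertCStar.AdjointableMap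

/-!
# Two harmonious projections on a Hilbert C⋆-module

If `S` is selfadjoint, the orthogonal complement of the closure of `𝓡(S)` is `𝓝(S)`, and for a
sum of two projections this null space is the intersection of the two null spaces. Applied to the four sums formed from `P`, `1 - P` and `Q`, `1 - Q`, harmony thus gives
projections `R₁, …, R₄` onto the four intersections
(`IsProjection.exists_isProjectionOnto_ker_inf_ker`). What remains of `P` and `1 - P` are the
projections `R₅` and `R₆`; the algebra of these six projections is `IsHalmosSystem`.

In a Hilbert C⋆-module an injective selfadjoint operator need not have dense range, so the polar
decomposition of `B = R₅ Q R₆` cannot be obtained from injectivity. Harmony enters a second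
time: each of the four sums has dense range on the generic part `𝓡(R₅ + R₆)`, hence so has their
product `(P - Q)² - (P - Q)⁴`, which commutes with `P` and coincides on `𝓡(R₅)` with
`B B* = Q₀ (1 - Q₀)` (`mul_four_factors`, `IsHalmosSystem.mem_closure_range`). By symmetry `B* B`
has dense range in `𝓡(R₆)`.

Consequently `Q₀^{1/2} (1 - Q₀)^{1/2}` and `B*` have dense ranges and the same modulus, and
`Q₀^{1/2} (1 - Q₀)^{1/2} x ↦ B* x` extends to a unitary (`exists_isUnitary_comp_eq`), whose adjoint
is `U₀`. The lower right corner of `T` is determined on the dense range of `B*` by the idempotency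
of `Q` (`exists_halmos_unitary`).

Square roots come from the continuous functional calculus. For this `𝓛(E)` is shown to be a
C⋆-algebra in which positivity of `T` amounts to `⟪T x, x⟫ ≥ 0` for all `x`
(`isPositive_iff_nonneg`).
-/

namespace HilbertCStar

/-! ### The C⋆-algebra of adjointable operators -/

namespace AdjointableMap

section Algebra

variable {A E F : Type*} [NonUnitalCStarAlgebra A] [PartialOrder A] [StarOrderedRing A]
  [NormedAddCommGroup E] [NormedSpace ℂ E] [SMul A E] [CStarModule A E]
  [NormedAddCommGroup F] [NormedSpace ℂ F] [SMul A F] [CStarModule A F]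

instance : Zero (AdjointableMap A E F) where
  zero := ⟨0, 0, fun x y => by simp⟩

instance : Neg (AdjointableMap A E F) where
  neg T := ⟨-T.toCLM, -T.adjCLM, fun x y => by simp [T.inner_adj]⟩

instance : SMul ℂ (AdjointableMap A E F) where
  smul c T := ⟨c • T.toCLM, star c • T.adjCLM, fun x y => by
    simp [T.inner_adj, CStarModule.inner_smul_left_complex]⟩

instance : Mul (AdjointableMap A E E) where
  mul S T := S.comp T

instance : Star (AdjointableMap A E E) where
  star T := T.adjoint

@[simp] theorem zero_apply (x : E) : (0 : AdjointableMap A E F) x = 0 := rfl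
@[simp] theorem neg_apply (T : AdjointableMap A E F) (x : E) : (-T) x = -T x := rfl
@[simp] theorem add_apply (S T : AdjointableMap A E F) (x : E) : (S + T) x = S x + T x := rfl
@[simp] theorem sub_apply (S T : AdjointableMap A E F) (x : E) : (S - T) x = S x - T x := rfl
@[simp] theorem smul_apply (c : ℂ) (T : AdjointableMap A E F) (x : E) : (c • T) x = c • T x := rfl
@[simp] theorem one_apply (x : E) : (1 : AdjointableMap A E E) x = x := rfl
@[simp] theorem mul_apply (S T : AdjointableMap A E E) (x : E) : (S * T) x = S (T x) := rfl

theorem inner_star_left (T : AdjointableMap A E E) (x y : E) : ⟪(star T) x, y⟫_A = ⟪x, T y⟫_A :=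
  T.inner_adj' x y

theorem inner_star_right (T : AdjointableMap A E E) (x y : E) : ⟪T x, y⟫_A = ⟪x, (star T) y⟫_A :=
  T.inner_adj x y

theorem inner_of_isSelfAdjoint {T : AdjointableMap A E E} (hT : IsSelfAdjoint T) (x y : E) :
    ⟪T x, y⟫_A = ⟪x, T y⟫_A := by
  rw [inner_star_right, hT.star_eq]

instance : Ring (AdjointableMap A E E) where
  add_assoc _ _ _ := ext fun _ => by simp [add_assoc]
  zero_add _ := ext fun _ => by simp
  add_zero _ := ext fun _ => by simp
  add_comm _ _ := ext fun _ => by simp [add_comm]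
  neg_add_cancel _ := ext fun _ => by simp
  sub_eq_add_neg _ _ := ext fun _ => by simp [sub_eq_add_neg]
  mul_assoc _ _ _ := ext fun _ => rfl
  one_mul _ := ext fun _ => rfl
  mul_one _ := ext fun _ => rfl
  left_distrib _ _ _ := ext fun _ => by simp
  right_distrib _ _ _ := ext fun _ => by simp
  zero_mul _ := ext fun _ => by simp
  mul_zero _ := ext fun _ => by simp
  nsmul := nsmulRec
  zsmul := zsmulRec

instance : Algebra ℂ (AdjointableMap A E E) :=
  letI : Module ℂ (AdjointableMap A E E) :=
    { one_smul := fun _ => ext fun _ => by simp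
      mul_smul := fun _ _ _ => ext fun _ => by simp [mul_smul]
      smul_zero := fun _ => ext fun _ => by simp
      smul_add := fun _ _ _ => ext fun _ => by simp
      add_smul := fun _ _ _ => ext fun _ => by simp [add_smul]
      zero_smul := fun _ => ext fun _ => by simp }
  Algebra.ofModule (fun _ _ _ => ext fun _ => by simp) (fun _ _ _ => ext fun _ => by simp)

instance : StarRing (AdjointableMap A E E) where
  star_involutive _ := rfl
  star_mul _ _ := rfl
  star_add _ _ := rfl

instance : StarModule ℂ (AdjointableMap A E E) where
  star_smul c T := ext fun x => by
    change (star c • T.adjCLM) x = star c • T.adjCLM x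
    rfl

/-- The inclusion of the adjointable operators into the bounded operators. -/
def toCLMRingHom : AdjointableMap A E E →+* (E →L[ℂ] E) where
  toFun := toCLM
  map_one' := rfl
  map_mul' _ _ := rfl
  map_zero' := rfl
  map_add' _ _ := rfl

theorem toCLM_injective : Function.Injective (toCLM : AdjointableMap A E F → E →L[ℂ] F) :=
  fun _ _ h => ext fun x => congrArg (fun f => f x) h

/-- The operator norm. -/
noncomputable instance : NormedRing (AdjointableMap A E E) :=
  NormedRing.induced _ _ toCLMRingHom toCLM_injective

theorem norm_def (T : AdjointableMap A E E) : ‖T‖ = ‖T.toCLM‖ := rfl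

noncomputable instance : NormedAlgebra ℂ (AdjointableMap A E E) where
  norm_smul_le c T := (norm_smul_le c T.toCLM)

instance : CStarRing (AdjointableMap A E E) where
  norm_mul_self_le T := by
    have h : ‖T.toCLM‖ ≤ √‖star T * T‖ := by
      refine T.toCLM.opNorm_le_bound (Real.sqrt_nonneg _) fun x => ?_
      refine le_of_sq_le_sq ?_ (by positivity)
      rw [mul_pow, Real.sq_sqrt (norm_nonneg _), CStarModule.norm_sq_eq A, inner_star_right]
      calc ‖⟪x, (star T) (T x)⟫_A‖ ≤ ‖x‖ * ‖(star T * T) x‖ := CStarModule.norm_inner_le E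
        _ ≤ ‖x‖ * (‖star T * T‖ * ‖x‖) := by gcongr; exact (star T * T).toCLM.le_opNorm x
        _ = _ := by ring
    calc ‖T‖ * ‖T‖ ≤ √‖star T * T‖ * √‖star T * T‖ := by rw [norm_def]; gcongr
      _ = _ := Real.mul_self_sqrt (norm_nonneg _)

/-- Norm limits of adjointable operators are adjointable: along a Cauchy sequence the adjoints
form a Cauchy sequence too, and the two limits are adjoint to each other. -/
instance [CompleteSpace E] : CompleteSpace (AdjointableMap A E E) := by
  refine Metric.complete_of_cauchySeq_tendsto fun u hu => ?_
  have h1 : ∀ v : ℕ → AdjointableMap A E E, CauchySeq v → CauchySeq fun n => (v n).toCLM :=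
    fun v hv => by
      rw [Metric.cauchySeq_iff] at hv ⊢
      exact hv
  have hu' : CauchySeq fun n => star (u n) := by
    rw [Metric.cauchySeq_iff] at hu ⊢
    simpa only [dist_eq_norm, ← star_sub, norm_star] using hu
  obtain ⟨f, hf⟩ := cauchySeq_tendsto_of_complete (h1 _ hu)
  obtain ⟨g, hg⟩ := cauchySeq_tendsto_of_complete (h1 _ hu')
  have hc : ∀ x : E, Continuous fun y : E => ⟪x, y⟫_A := fun x =>
    CStarModule.continuous_inner.comp (Continuous.prodMk_right x)
  have hc' : ∀ y : E, Continuous fun x : E => ⟪x, y⟫_A := fun y =>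
    CStarModule.continuous_inner.comp (Continuous.prodMk_left y)
  refine ⟨⟨f, g, fun x y => ?_⟩, ?_⟩
  · have h2 : Filter.Tendsto (fun n => ⟪u n x, y⟫_A) Filter.atTop (nhds ⟪f x, y⟫_A) :=
      ((hc' y).tendsto _).comp ((ContinuousLinearMap.apply ℂ E x).continuous.tendsto f |>.comp hf)
    have h3 : Filter.Tendsto (fun n => ⟪x, (star (u n)) y⟫_A) Filter.atTop (nhds ⟪x, g y⟫_A) :=
      ((hc x).tendsto _).comp ((ContinuousLinearMap.apply ℂ E y).continuous.tendsto g |>.comp hg)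
    refine tendsto_nhds_unique h2 (h3.congr fun n => ?_)
    rw [inner_star_right]
  · rw [tendsto_iff_norm_sub_tendsto_zero] at hf ⊢
    exact hf

noncomputable instance [CompleteSpace E] : CStarAlgebra (AdjointableMap A E E) where

end Algebra

/-! ### Positive operators and square roots -/

section Positive

variable {A E : Type*} [NonUnitalCStarAlgebra A] [PartialOrder A] [StarOrderedRing A]
  [NormedAddCommGroup E] [NormedSpace ℂ E] [SMul A E] [CStarModule A E]

/-- Polarization: a sesquilinear form is determined by its quadratic form. -/
theorem eq_of_forall_inner_self {S T : AdjointableMap A E E}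
    (h : ∀ x : E, ⟪S x, x⟫_A = ⟪T x, x⟫_A) : S = T := by
  rw [← sub_eq_zero]
  set R := S - T with hR
  have h0 : ∀ x : E, ⟪R x, x⟫_A = 0 := fun x => by
    rw [hR, sub_apply, CStarModule.inner_sub_left, h, sub_self]
  have h1 : ∀ x y : E, ⟪R x, y⟫_A + ⟪R y, x⟫_A = 0 := fun x y => by
    have := h0 (x + y)
    simpa [CStarModule.inner_add_left, h0, add_comm] using this
  refine ext fun x => ext_inner (A := A) fun y => ?_
  have h2 := h1 x y
  have h3 := h1 (Complex.I • x) y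
  simp only [map_smul, CStarModule.inner_smul_left_complex, CStarModule.inner_smul_right_complex,
    Complex.star_def, Complex.conj_I, neg_smul] at h3
  have h4 : ⟪R y, x⟫_A = ⟪R x, y⟫_A := by
    rw [neg_add_eq_zero] at h3
    exact ((IsUnit.mk0 _ Complex.I_ne_zero).smul_left_cancel.mp h3).symm
  rw [h4, ← two_smul ℂ, smul_eq_zero] at h2
  rw [← CStarModule.star_inner, h2.resolve_left two_ne_zero]
  simp

theorem IsPositive.isSelfAdjoint {T : AdjointableMap A E E} (hT : T.IsPositive) :
    IsSelfAdjoint T := by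
  refine eq_of_forall_inner_self fun x => ?_
  rw [inner_star_left, ← CStarModule.star_inner, (hT x).isSelfAdjoint.star_eq]

theorem isPositive_star_mul_self (T : AdjointableMap A E E) : (star T * T).IsPositive := fun x => by
  rw [mul_apply, inner_star_left]
  exact CStarModule.inner_self_nonneg

variable [CompleteSpace E]

attribute [local instance] CStarAlgebra.spectralOrder CStarAlgebra.spectralOrderedRing

/-- Positivity in the sense of the `A`-valued inner product is positivity in the C⋆-algebra of
adjointable operators. For the direct implication, if `T⁻` is the negative part of `T`, then
`⟪T T⁻ x, T⁻ x⟫ = -⟪(T⁻)³ x, x⟫` is both nonnegative and nonpositive, so `(T⁻)³ = 0`. -/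
theorem isPositive_iff_nonneg {T : AdjointableMap A E E} : T.IsPositive ↔ 0 ≤ T := by
  have key : ∀ S : AdjointableMap A E E, 0 ≤ S → S.IsPositive := fun S hS => by
    obtain ⟨R, rfl⟩ := CStarAlgebra.nonneg_iff_eq_star_mul_self.mp hS
    exact isPositive_star_mul_self R
  refine ⟨fun hT => ?_, key T⟩
  have hsa := hT.isSelfAdjoint
  have hn : 0 ≤ T⁻ := CFC.negPart_nonneg T
  have hn' : IsSelfAdjoint T⁻ := hn.isSelfAdjoint
  have h1 : T⁻ * T * T⁻ = -(T⁻ * T⁻ * T⁻) := by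
    have h : T⁻ * T = -(T⁻ * T⁻) :=
      calc T⁻ * T = T⁻ * (T⁺ - T⁻) := by rw [CFC.posPart_sub_negPart T hsa]
        _ = _ := by rw [mul_sub, CFC.negPart_mul_posPart, zero_sub]
    rw [h, neg_mul]
  have h2 : 0 ≤ T⁻ * T⁻ * T⁻ := by
    simpa [hn'.star_eq] using star_left_conjugate_nonneg hn T⁻
  have h3 : T⁻ * T⁻ * T⁻ = 0 := by
    refine eq_of_forall_inner_self fun x => ?_
    rw [zero_apply, CStarModule.inner_zero_left]
    refine le_antisymm ?_ (key _ h2 x)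
    have h4 := hT (T⁻ x)
    rw [← inner_of_isSelfAdjoint hn'] at h4
    change 0 ≤ ⟪(T⁻ * T * T⁻) x, x⟫_A at h4
    rw [h1, neg_apply, CStarModule.inner_neg_left] at h4
    simpa using h4
  have h5 : T⁻ = 0 := by
    have h6 : T⁻ * T⁻ = 0 := by
      rw [← CStarRing.star_mul_self_eq_zero_iff, star_mul, hn'.star_eq, ← mul_assoc, h3, zero_mul]
    rwa [← CStarRing.star_mul_self_eq_zero_iff, hn'.star_eq]
  rw [← CFC.posPart_sub_negPart T hsa, h5, sub_zero]
  exact CFC.posPart_nonneg T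

/-- A positive operator has a unique positive square root. The second part says that this root
commutes with everything that commutes with the operator. -/
theorem IsPositive.exists_isPositiveSqrt {T : AdjointableMap A E E} (hT : T.IsPositive) :
    ∃ R : AdjointableMap A E E, R.IsPositiveSqrt T ∧
      ∀ S : AdjointableMap A E E, Commute T S → Commute R S := by
  have h0 := isPositive_iff_nonneg.mp hT
  refine ⟨CFC.sqrt T, ⟨isPositive_iff_nonneg.mpr (CFC.sqrt_nonneg T), CFC.sqrt_mul_sqrt_self T h0,
    fun S hS h => (CFC.sqrt_unique h (isPositive_iff_nonneg.mp hS)).symm⟩, fun S hS => ?_⟩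
  rw [CFC.sqrt_eq_cfc]
  exact hS.cfc_nnreal _

end Positive

/-! ### Projections and orthogonally complemented submodules -/

section Projections

variable {A E F G : Type*} [NonUnitalCStarAlgebra A] [PartialOrder A] [StarOrderedRing A]
  [NormedAddCommGroup E] [NormedSpace ℂ E] [SMul A E] [CStarModule A E]
  [NormedAddCommGroup F] [NormedSpace ℂ F] [SMul A F] [CStarModule A F]
  [NormedAddCommGroup G] [NormedSpace ℂ G] [SMul A G] [CStarModule A G]

theorem mem_range {T : AdjointableMap A E F} {y : F} : y ∈ T.range ↔ ∃ x, T x = y := Iff.rfl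

theorem mem_ker {T : AdjointableMap A E F} {x : E} : x ∈ T.ker ↔ T x = 0 := Iff.rfl

theorem mem_range_closure {T : AdjointableMap A E F} {y : F} :
    y ∈ T.range.closure ↔ y ∈ closure (Set.range T) := Iff.rfl

theorem isProjection_iff {P : AdjointableMap A E E} : P.IsProjection ↔ IsStarProjection P :=
  ⟨fun h => ⟨h.1, h.2⟩, fun h => ⟨h.1, h.2⟩⟩

theorem IsProjection.apply_apply {P : AdjointableMap A E E} (hP : P.IsProjection) (x : E) :
    P (P x) = P x :=
  congrArg (fun T : AdjointableMap A E E => T x) hP.1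

theorem IsProjection.mem_range_iff {P : AdjointableMap A E E} (hP : P.IsProjection) {x : E} :
    x ∈ P.range ↔ P x = x :=
  ⟨fun ⟨y, hy⟩ => by rw [← hy]; exact hP.apply_apply y, fun h => ⟨x, h⟩⟩

theorem IsProjection.inner_apply_left {P : AdjointableMap A E E} (hP : P.IsProjection) (x y : E) :
    ⟪P x, y⟫_A = ⟪x, P y⟫_A :=
  inner_of_isSelfAdjoint (isProjection_iff.mp hP).isSelfAdjoint x y

theorem IsProjection.one_sub {P : AdjointableMap A E E} (hP : P.IsProjection) :
    (1 - P).IsProjection :=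
  isProjection_iff.mpr (isProjection_iff.mp hP).one_sub

theorem IsProjection.ker_one_sub {P : AdjointableMap A E E} (hP : P.IsProjection) :
    (1 - P).ker = P.range := by
  refine SetLike.ext fun x => ?_
  rw [hP.mem_range_iff, mem_ker, sub_apply, one_apply, sub_eq_zero, eq_comm]

theorem IsProjection.isClosed_range {P : AdjointableMap A E E} (hP : P.IsProjection) :
    IsClosed (P.range : Set E) := by
  rw [← hP.ker_one_sub]
  exact (1 - P).toCLM.isClosed_ker

theorem IsProjection.completeSpace_range [CompleteSpace E] {P : AdjointableMap A E E}
    (hP : P.IsProjection) : CompleteSpace P.range :=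
  hP.isClosed_range.completeSpace_coe

theorem IsProjection.inner_apply_self {P : AdjointableMap A E E} (hP : P.IsProjection) (x : E) :
    ⟪P x, x⟫_A = ⟪P x, P x⟫_A := by
  rw [hP.inner_apply_left, hP.inner_apply_left, hP.apply_apply]

theorem IsProjection.norm_apply_le {P : AdjointableMap A E E} (hP : P.IsProjection) (x : E) :
    ‖P x‖ ≤ ‖x‖ := by
  have h : ‖P x‖ * ‖P x‖ ≤ ‖P x‖ * ‖x‖ := by
    rw [← sq, CStarModule.norm_sq_eq A, ← hP.inner_apply_self]
    exact CStarModule.norm_inner_le E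
  by_contra! hx
  exact absurd h (not_le.mpr (mul_lt_mul_of_pos_left hx ((norm_nonneg x).trans_lt hx)))

/-- If `R` maps into the range of `P`, then `P R = R`. -/
theorem IsProjection.mul_eq_right {P R : AdjointableMap A E E} (hP : P.IsProjection)
    (h : ∀ x ∈ R.range, x ∈ P.range) : P * R = R :=
  ext fun x => hP.mem_range_iff.mp (h _ ⟨x, rfl⟩)

theorem mul_eq_zero_of_range_le_ker {P R : AdjointableMap A E E}
    (h : ∀ x ∈ R.range, x ∈ P.ker) : P * R = 0 :=
  ext fun x => h _ ⟨x, rfl⟩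

/-- The null space of a sum of two projections is the intersection of their null spaces. -/
theorem IsProjection.ker_add {P Q : AdjointableMap A E E} (hP : P.IsProjection)
    (hQ : Q.IsProjection) : (P + Q).ker = P.ker ⊓ Q.ker := by
  refine SetLike.ext fun x => ⟨fun h => ?_, fun h => ?_⟩
  · have h1 : ⟪P x, P x⟫_A + ⟪Q x, Q x⟫_A = 0 := by
      rw [← hP.inner_apply_self, ← hQ.inner_apply_self, ← CStarModule.inner_add_left,
        ← add_apply, mem_ker.mp h, CStarModule.inner_zero_left]
    have h2 := (add_eq_zero_iff_of_nonneg (CStarModule.inner_self_nonneg (A := A) (x := P x))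
      (CStarModule.inner_self_nonneg (A := A) (x := Q x))).mp h1
    exact ⟨CStarModule.inner_self.mp h2.1, CStarModule.inner_self.mp h2.2⟩
  · have h1 : P x = 0 := h.1
    have h2 : Q x = 0 := h.2
    rw [mem_ker, add_apply, h1, h2, add_zero]

/-- For a selfadjoint operator, `(closure of 𝓡(T))^⊥ = 𝓝(T)`. -/
theorem orth_closure_range {T : AdjointableMap A E E} (hT : IsSelfAdjoint T) :
    T.range.closure.orth = T.ker := by
  refine SetLike.ext fun x => ⟨fun h => ?_, fun h y hy => ?_⟩
  · have h1 := h (T (T x)) (subset_closure ⟨T x, rfl⟩)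
    rw [← inner_of_isSelfAdjoint hT] at h1
    exact CStarModule.inner_self.mp h1
  · have hc : IsClosed {y : E | ⟪x, y⟫_A = 0} :=
      isClosed_eq (CStarModule.continuous_inner.comp (Continuous.prodMk_right x)) continuous_const
    refine closure_minimal ?_ hc (mem_range_closure.mp hy)
    rintro _ ⟨w, rfl⟩
    rw [Set.mem_ofPred_eq, ← inner_of_isSelfAdjoint hT, mem_ker.mp h, CStarModule.inner_zero_left]

/-- The orthogonal complement of an orthogonally complemented submodule is the range of a
projection. -/
theorem exists_isProjectionOnto_orth {M : CStarSubmodule A E} (hM : M.IsOrthComplemented) :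
    ∃ R : AdjointableMap A E E, R.IsProjectionOnto M.orth := by
  -- `z x` is the component of `x` in the complement; it is unique, hence linear in `x`
  choose y hy z hz hxyz using hM
  have inner_yz : ∀ a ∈ M, ∀ b ∈ M.orth, ⟪a, b⟫_A = 0 := fun a ha b hb => by
    rw [← CStarModule.star_inner, hb a ha, star_zero]
  have uniq : ∀ a b c, a ∈ M → b ∈ M.orth → c = a + b → z c = b := fun a b c ha hb h => by
    have h1 : z c - b = a - y c := by
      rw [sub_eq_sub_iff_add_eq_add, add_comm (z c), ← hxyz, h]
    rw [← sub_eq_zero, ← CStarModule.inner_self (A := A)]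
    nth_rw 2 [h1]
    exact sub_mem (hz c) hb _ (sub_mem ha (hy c))
  have hz_norm : ∀ x, ‖z x‖ ≤ 1 * ‖x‖ := fun x => by
    have h : ⟪z x, x⟫_A = ⟪z x, z x⟫_A := by
      nth_rw 2 [hxyz x]
      rw [CStarModule.inner_add_right, hz x _ (hy x), zero_add]
    have h : ‖z x‖ * ‖z x‖ ≤ ‖z x‖ * ‖x‖ := by
      rw [← sq, CStarModule.norm_sq_eq A, ← h]
      exact CStarModule.norm_inner_le E
    rw [one_mul]
    by_contra! hx
    exact absurd h (not_le.mpr (mul_lt_mul_of_pos_left hx ((norm_nonneg x).trans_lt hx)))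
  let Z : E →L[ℂ] E := LinearMap.mkContinuous
    { toFun := z
      map_add' := fun a b => uniq (y a + y b) _ _ (add_mem (hy a) (hy b)) (add_mem (hz a) (hz b))
        (by nth_rw 1 [hxyz a, hxyz b]; abel)
      map_smul' := fun c a => uniq (c • y a) _ _ (M.toSubmodule.smul_mem c (hy a))
        (M.orth.toSubmodule.smul_mem c (hz a)) (by nth_rw 1 [hxyz a]; rw [smul_add]; rfl) } 1 hz_norm
  have hzz : ∀ b ∈ M.orth, z b = b := fun b hb => uniq 0 b b (zero_mem M) hb (zero_add b).symm
  refine ⟨⟨Z, Z, fun a b => ?_⟩, ⟨ext fun a => hzz _ (hz a), rfl⟩, SetLike.ext fun x => ?_⟩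
  · change ⟪z a, b⟫_A = ⟪a, z b⟫_A
    nth_rw 1 [hxyz b]
    nth_rw 2 [hxyz a]
    rw [CStarModule.inner_add_right, CStarModule.inner_add_left, hz a _ (hy b),
      inner_yz _ (hy a) _ (hz b)]
  · exact ⟨fun ⟨w, hw⟩ => hw ▸ hz w, fun hx => ⟨x, hzz x hx⟩⟩

/-- If the closure of the range of a sum of two projections is orthogonally complemented, then
there is a projection onto the intersection of their null spaces, and an operator `N` vanishing on
that intersection satisfies `𝓡(N) ⊆ closure of 𝓡(N (P + Q))`. -/
theorem IsProjection.exists_isProjectionOnto_ker_inf_ker {P Q : AdjointableMap A E E}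
    (hP : P.IsProjection) (hQ : Q.IsProjection)
    (h : (P + Q).range.closure.IsOrthComplemented) :
    ∃ R : AdjointableMap A E E, R.IsProjectionOnto (P.ker ⊓ Q.ker) ∧
      ∀ N : AdjointableMap A E E, N * R = 0 →
        ∀ x, N x ∈ (N * (P + Q)).range.closure := by
  have hsa : IsSelfAdjoint (P + Q) :=
    (isProjection_iff.mp hP).isSelfAdjoint.add (isProjection_iff.mp hQ).isSelfAdjoint
  have ho := (orth_closure_range hsa).trans (hP.ker_add hQ)
  obtain ⟨R, hR⟩ := exists_isProjectionOnto_orth h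
  rw [ho] at hR
  refine ⟨R, hR, fun N hN x => ?_⟩
  obtain ⟨y, hy, z, hz, rfl⟩ := h x
  rw [ho, ← hR.2] at hz
  obtain ⟨w, hw⟩ := mem_range.mp hz
  have h0 : N z = 0 := by
    rw [← hw]
    exact congrArg (fun T : AdjointableMap A E E => T w) hN
  rw [map_add, h0, add_zero]
  refine map_mem_closure N.toCLM.continuous (mem_range_closure.mp hy) ?_
  rintro _ ⟨v, rfl⟩
  exact ⟨v, rfl⟩

/-- Relative density of ranges passes to products with a commuting factor. -/
theorem mem_closure_range_mul {N S T : AdjointableMap A E E} (hNS : Commute N S)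
    (hS : ∀ x, N x ∈ (N * S).range.closure) (hT : ∀ x, N x ∈ (N * T).range.closure)
    (x : E) : N x ∈ (N * (S * T)).range.closure := by
  refine closure_minimal ?_ isClosed_closure (hS x)
  rintro _ ⟨y, rfl⟩
  have hy : (N * S) y = S (N y) := by rw [hNS.eq, mul_apply]
  change (N * S) y ∈ closure (Set.range (N * (S * T)).toCLM)
  rw [hy]
  refine map_mem_closure S.toCLM.continuous (hT y) ?_
  rintro _ ⟨z, rfl⟩
  exact ⟨z, by rw [← mul_assoc, hNS.eq]; rfl⟩

/-! ### Compressions -/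

theorem coe_compress_apply {R S : AdjointableMap A E E} (hR : R.IsProjection) (hS : S.IsProjection)
    (T : AdjointableMap A E E) (x : S.range) : (compress hR hS T x : E) = R (T x) := by
  change R (T (S x)) = _
  rw [hS.mem_range_iff.mp x.2]

theorem denseRange_compress {R S : AdjointableMap A E E} (hR : R.IsProjection)
    (hS : S.IsProjection) {T : AdjointableMap A E E}
    (h : ∀ x, R x ∈ (R * T * S).range.closure) : DenseRange (compress hR hS T) := by
  intro x
  rw [closure_subtype]
  have hx := h x
  rw [hR.mem_range_iff.mp x.2] at hx
  refine closure_mono ?_ hx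
  rintro _ ⟨w, rfl⟩
  exact ⟨_, ⟨⟨S w, ⟨w, rfl⟩⟩, rfl⟩, by
    rw [coe_compress_apply]; rfl⟩

theorem adjoint_compress {R S : AdjointableMap A E E} (hR : R.IsProjection) (hS : S.IsProjection)
    {T : AdjointableMap A E E} (hT : IsSelfAdjoint T) :
    (compress hR hS T).adjoint = compress hS hR T := by
  refine ext fun x => Subtype.ext ?_
  change S (T.adjCLM (R x)) = S (T (R x))
  rw [show T.adjCLM = T.toCLM from congrArg toCLM hT]

theorem one_sub_compress {R : AdjointableMap A E E} (hR : R.IsProjection)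
    (T : AdjointableMap A E E) : 1 - compress hR hR T = compress hR hR (1 - T) := by
  refine ext fun x => Subtype.ext ?_
  rw [coe_compress_apply, sub_apply, sub_apply, map_sub, one_apply, one_apply,
    hR.mem_range_iff.mp x.2, AddSubgroupClass.coe_sub, coe_compress_apply]

theorem isPositive_compress {R Q : AdjointableMap A E E} (hR : R.IsProjection)
    (hQ : Q.IsProjection) : (compress hR hR Q).IsPositive := fun x => by
  change 0 ≤ ⟪(compress hR hR Q x : E), (x : E)⟫_A
  rw [coe_compress_apply, hR.inner_apply_left, hR.mem_range_iff.mp x.2, hQ.inner_apply_self]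
  exact CStarModule.inner_self_nonneg

theorem norm_compress_le {R Q : AdjointableMap A E E} (hR : R.IsProjection)
    (hQ : Q.IsProjection) : ‖(compress hR hR Q).toCLM‖ ≤ 1 := by
  refine ContinuousLinearMap.opNorm_le_bound _ zero_le_one fun x => ?_
  change ‖(compress hR hR Q x : E)‖ ≤ 1 * ‖(x : E)‖
  rw [coe_compress_apply, one_mul]
  exact (hR.norm_apply_le _).trans (hQ.norm_apply_le _)

/-- The compression `R Q R` of a projection `Q` is injective if `𝓡(R) ∩ 𝓝(Q) = 0`. -/
theorem injective_compress {R Q : AdjointableMap A E E} (hR : R.IsProjection)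
    (hQ : Q.IsProjection) (h : ∀ x ∈ R.range, x ∈ Q.ker → x = 0) :
    Function.Injective (compress hR hR Q).toCLM := by
  rw [injective_iff_map_eq_zero]
  intro x hx
  have h1 : ⟪Q x, Q x⟫_A = 0 := by
    rw [← hQ.inner_apply_self]
    nth_rw 2 [← hR.mem_range_iff.mp x.2]
    rw [← hR.inner_apply_left, ← coe_compress_apply hR hR, hx, ZeroMemClass.coe_zero,
      CStarModule.inner_zero_left]
  exact Subtype.ext (h x x.2 (CStarModule.inner_self.mp h1))

/-! ### Polar decomposition with dense ranges -/

/-- If `X* X = Y* Y` and both `X` and `Y` have dense range, then `X x ↦ Y x` extends to a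
unitary operator. -/
theorem exists_isUnitary_comp_eq [CompleteSpace F] [CompleteSpace G]
    {X : AdjointableMap A E F} {Y : AdjointableMap A E G} (hX : DenseRange X) (hY : DenseRange Y)
    (h : X.adjoint.comp X = Y.adjoint.comp Y) :
    ∃ V : AdjointableMap A F G, V.IsUnitary ∧ V.comp X = Y := by
  have hin : ∀ x y, ⟪X x, X y⟫_A = ⟪Y x, Y y⟫_A := fun x y => by
    rw [X.inner_adj, Y.inner_adj]
    exact congrArg (fun T : AdjointableMap A E E => ⟪x, T y⟫_A) h
  have hn : ∀ x, ‖X x‖ = ‖Y x‖ := fun x => by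
    rw [CStarModule.norm_eq_sqrt_norm_inner_self (A := A), hin,
      ← CStarModule.norm_eq_sqrt_norm_inner_self]
  let V : F →L[ℂ] G := Y.toCLM.toLinearMap.extendOfNorm X.toCLM.toLinearMap
  let W : G →L[ℂ] F := X.toCLM.toLinearMap.extendOfNorm Y.toCLM.toLinearMap
  have hV : ∀ x, V (X x) = Y x := fun x =>
    LinearMap.extendOfNorm_eq hX ⟨1, fun x => by rw [one_mul]; exact (hn x).ge⟩ x
  have hW : ∀ x, W (Y x) = X x := fun x =>
    LinearMap.extendOfNorm_eq hY ⟨1, fun x => by rw [one_mul]; exact (hn x).le⟩ x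
  have hVW : ∀ u v, ⟪V u, v⟫_A = ⟪u, W v⟫_A := fun u v => by
    have hcV : Continuous fun p : F × G => ⟪V p.1, p.2⟫_A :=
      CStarModule.continuous_inner.comp ((V.continuous.comp continuous_fst).prodMk continuous_snd)
    have hcW : Continuous fun p : F × G => ⟪p.1, W p.2⟫_A :=
      CStarModule.continuous_inner.comp (continuous_fst.prodMk (W.continuous.comp continuous_snd))
    refine congrFun ((hX.prodMap hY).equalizer hcV hcW (funext fun p => ?_)) (u, v)
    change ⟪V (X p.1), Y p.2⟫_A = ⟪X p.1, W (Y p.2)⟫_A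
    rw [hV, hW, hin]
  refine ⟨⟨V, W, hVW⟩, ⟨?_, ?_⟩, ext hV⟩
  · refine ext fun u => congrFun (hX.equalizer (W.comp V).continuous continuous_id
      (funext fun x => ?_)) u
    change W (V (X x)) = X x
    rw [hV, hW]
  · refine ext fun u => congrFun (hY.equalizer (V.comp W).continuous continuous_id
      (funext fun x => ?_)) u
    change V (W (Y x)) = Y x
    rw [hW, hV]

theorem comp_right_cancel {X : AdjointableMap A E F} (hX : DenseRange X)
    {S T : AdjointableMap A F G} (h : S.comp X = T.comp X) : S = T :=
  ext fun y => congrFun (hX.equalizer S.toCLM.continuous T.toCLM.continuous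
    (funext fun x => congrArg (fun R : AdjointableMap A E G => R x) h)) y

/-- The two projections formula in abstract form: `S`, `B`, `K` play the role of the entries of
the operator matrix of the second projection. The relations `B B* = S (1 - S)` and
`K B* = B* (1 - S)` express that the matrix is idempotent. -/
theorem exists_halmos_unitary [CompleteSpace E] [CompleteSpace F] {S : AdjointableMap A E E}
    {B : AdjointableMap A F E} {K : AdjointableMap A F F} (hS : S.IsPositive)
    (hS' : (1 - S).IsPositive) (hB : B.comp B.adjoint = S.comp (1 - S))
    (hK : K.comp B.adjoint = B.adjoint.comp (1 - S)) (hd : DenseRange (B.comp B.adjoint))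
    (hd' : DenseRange B.adjoint) :
    ∃ (U : AdjointableMap A F E) (C D : AdjointableMap A E E),
      U.IsUnitary ∧ C.IsPositiveSqrt S ∧ D.IsPositiveSqrt (1 - S) ∧
      B = (C.comp D).comp U ∧ B.adjoint = U.adjoint.comp (C.comp D) ∧
      K = U.adjoint.comp ((1 - S).comp U) := by
  obtain ⟨C, hC, hCc⟩ := hS.exists_isPositiveSqrt
  obtain ⟨D, hD, hDc⟩ := hS'.exists_isPositiveSqrt
  have hSS : Commute S (1 - S) := (Commute.one_right S).sub_right (Commute.refl S)
  have hCS : Commute C (1 - S) := hCc _ hSS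
  have hCD : Commute C D := (hDc _ hCS.symm).symm
  have hDS : Commute D (1 - S) := hDc _ (Commute.refl _)
  have hsq : (C * D) * (C * D) = S * (1 - S) := by
    rw [mul_assoc, ← mul_assoc D, ← hCD.eq, mul_assoc, ← mul_assoc C C]
    exact congrArg₂ (· * ·) hC.2.1 hD.2.1
  have hsa : star (C * D) = C * D := by
    rw [star_mul, hC.1.isSelfAdjoint.star_eq, hD.1.isSelfAdjoint.star_eq, hCD.eq]
  -- the range of `C D` contains that of `(C D)² = B B*`
  have hdX : DenseRange (C * D) := by
    refine hd.mono ?_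
    rintro _ ⟨x, rfl⟩
    refine ⟨(C * D) x, ?_⟩
    rw [← mul_apply, hsq, hB]
    rfl
  obtain ⟨V, hV, hVX⟩ := exists_isUnitary_comp_eq (X := C * D) (Y := B.adjoint) hdX hd' <| by
    change star (C * D) * (C * D) = B.comp B.adjoint
    rw [hsa, hsq, hB]
    rfl
  refine ⟨V.adjoint, C, D, ⟨hV.2, hV.1⟩, hC, hD, ?_, hVX.symm, ?_⟩
  · have h := congrArg adjoint hVX
    change (star (C * D)).comp V.adjoint = B at h
    rw [hsa] at h
    exact h.symm
  · -- `K V C D = K B* = B* (1 - S) = V (1 - S) C D`, and `C D` has dense range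
    have h : K.comp V = V.comp (1 - S) := by
      refine comp_right_cancel hdX ?_
      change K.comp (V.comp (C * D)) = V.comp ((1 - S) * (C * D))
      rw [hVX, hK, ← hVX]
      exact congrArg V.comp (hCS.mul_left hDS).eq
    have h2 : (K.comp V).comp V.adjoint = K := congrArg K.comp hV.2
    rw [← h2, h]
    rfl

end Projections

/-! ### Two projections -/

section TwoProjections

variable {A H : Type*} [NonUnitalCStarAlgebra A] [PartialOrder A] [StarOrderedRing A]
  [NormedAddCommGroup H] [NormedSpace ℂ H] [SMul A H] [CStarModule A H]

theorem IsProjection.isOrthogonalDecomposition {n : ℕ} {R : Fin n → AdjointableMap A H H}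
    (hR : ∀ i, (R i).IsProjection) (h : ∀ i j, i ≠ j → R i * R j = 0) (hsum : ∑ i, R i = 1) :
    CStarSubmodule.IsOrthogonalDecomposition fun i => (R i).range := by
  refine ⟨?_, fun x => ⟨fun i => R i x, fun i => ⟨x, rfl⟩, ?_⟩⟩
  · rintro i j hij _ ⟨u, rfl⟩ _ ⟨v, rfl⟩
    change ⟪R i u, R j v⟫_A = 0
    rw [(hR i).inner_apply_left, ← mul_apply, h i j hij, zero_apply, CStarModule.inner_zero_right]
  · have hs : ∀ s : Finset (Fin n), (∑ i ∈ s, R i) x = ∑ i ∈ s, R i x := fun s => by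
      induction s using Finset.cons_induction with
      | empty => rfl
      | cons a s ha ih => rw [Finset.sum_cons, Finset.sum_cons, add_apply, ih]
    rw [← hs, hsum, one_apply]

/-- With `Z = (P + Q)(2 - P - Q)(P + 1 - Q)(1 - P + Q) = (P - Q)² - (P - Q)⁴`, one has
`P Z = P Q (1 - P) Q P`. -/
theorem mul_four_factors {R : Type*} [Ring R] {P Q : R} (hP : P * P = P) (hQ : Q * Q = Q) :
    P * (((P + Q) * ((1 - P) + (1 - Q))) * ((P + (1 - Q)) * ((1 - P) + Q))) =
      P * Q * (1 - P) * Q * P := by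
  have hP' : ∀ x, P * (P * x) = P * x := fun x => by rw [← mul_assoc, hP]
  have hQ' : ∀ x, Q * (Q * x) = Q * x := fun x => by rw [← mul_assoc, hQ]
  have h1 : (P + Q) * ((1 - P) + (1 - Q)) = P + Q - P * Q - Q * P := by
    simp only [mul_add, add_mul, mul_sub, mul_one, hP, hQ]
    abel
  have h2 : (P + (1 - Q)) * ((1 - P) + Q) = 1 - P - Q + P * Q + Q * P := by
    simp only [mul_add, add_mul, mul_sub, sub_mul, mul_one, one_mul, hP, hQ]
    abel
  rw [h1, h2]
  simp only [mul_add, add_mul, mul_sub, sub_mul, mul_one, mul_assoc, hP, hQ, hP', hQ']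
  abel

/-- A system of projections `R₁, …, R₄` in a `⋆`-ring on which the projections `P` and `Q` act
as `1` or as `0`: on `R₁` both are `1`, on `R₂` only `P` is, on `R₃` only `Q` is, and on `R₄`
both are `0`. The remaining parts of `P` and `1 - P` are called `R₅ = P - R₁ - R₂` and
`R₆ = (1 - P) - R₃ - R₄`; they make up the generic part. -/
structure IsHalmosSystem {R : Type*} [Ring R] [StarRing R] (P Q R₁ R₂ R₃ R₄ : R) : Prop where
  hP : IsStarProjection P
  hQ : IsStarProjection Q
  h₁ : IsStarProjection R₁
  h₂ : IsStarProjection R₂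
  h₃ : IsStarProjection R₃
  h₄ : IsStarProjection R₄
  P₁ : P * R₁ = R₁
  P₂ : P * R₂ = R₂
  P₃ : P * R₃ = 0
  P₄ : P * R₄ = 0
  Q₁ : Q * R₁ = R₁
  Q₂ : Q * R₂ = 0
  Q₃ : Q * R₃ = R₃
  Q₄ : Q * R₄ = 0

theorem _root_.IsStarProjection.mul_eq_zero_comm {R : Type*} [Ring R] [StarRing R] {e f : R}
    (he : IsStarProjection e) (hf : IsStarProjection f) (h : e * f = 0) : f * e = 0 := by
  have := congrArg star h
  rwa [star_mul, star_zero, he.isSelfAdjoint.star_eq, hf.isSelfAdjoint.star_eq] at this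

theorem _root_.IsStarProjection.mul_eq_comm {R : Type*} [Ring R] [StarRing R] {e f : R}
    (he : IsStarProjection e) (hf : IsStarProjection f) (h : e * f = f) : f * e = f := by
  have := congrArg star h
  rwa [star_mul, he.isSelfAdjoint.star_eq, hf.isSelfAdjoint.star_eq] at this

namespace IsHalmosSystem

section Ring

variable {R : Type*} [Ring R] [StarRing R] {P Q R₁ R₂ R₃ R₄ : R}

/-- The roles of `P` and `1 - P` may be exchanged. -/
theorem swap (h : IsHalmosSystem P Q R₁ R₂ R₃ R₄) : IsHalmosSystem (1 - P) Q R₃ R₄ R₁ R₂ where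
  hP := h.hP.one_sub
  hQ := h.hQ
  h₁ := h.h₃
  h₂ := h.h₄
  h₃ := h.h₁
  h₄ := h.h₂
  P₁ := by rw [sub_mul, one_mul, h.P₃, sub_zero]
  P₂ := by rw [sub_mul, one_mul, h.P₄, sub_zero]
  P₃ := by rw [sub_mul, one_mul, h.P₁, sub_self]
  P₄ := by rw [sub_mul, one_mul, h.P₂, sub_self]
  Q₁ := h.Q₃
  Q₂ := h.Q₄
  Q₃ := h.Q₁
  Q₄ := h.Q₂

theorem mul₁₂ (h : IsHalmosSystem P Q R₁ R₂ R₃ R₄) : R₁ * R₂ = 0 := by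
  rw [← h.hQ.mul_eq_comm h.h₁ h.Q₁, mul_assoc, h.Q₂, mul_zero]

theorem mul₁₃ (h : IsHalmosSystem P Q R₁ R₂ R₃ R₄) : R₁ * R₃ = 0 := by
  rw [← h.hP.mul_eq_comm h.h₁ h.P₁, mul_assoc, h.P₃, mul_zero]

theorem mul₁₄ (h : IsHalmosSystem P Q R₁ R₂ R₃ R₄) : R₁ * R₄ = 0 := by
  rw [← h.hP.mul_eq_comm h.h₁ h.P₁, mul_assoc, h.P₄, mul_zero]

theorem mul₂₃ (h : IsHalmosSystem P Q R₁ R₂ R₃ R₄) : R₂ * R₃ = 0 := by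
  rw [← h.hP.mul_eq_comm h.h₂ h.P₂, mul_assoc, h.P₃, mul_zero]

theorem mul₂₄ (h : IsHalmosSystem P Q R₁ R₂ R₃ R₄) : R₂ * R₄ = 0 := by
  rw [← h.hP.mul_eq_comm h.h₂ h.P₂, mul_assoc, h.P₄, mul_zero]

theorem mul₁₅ (h : IsHalmosSystem P Q R₁ R₂ R₃ R₄) : R₁ * (P - R₁ - R₂) = 0 := by
  rw [mul_sub, mul_sub, h.hP.mul_eq_comm h.h₁ h.P₁, h.h₁.isIdempotentElem.eq, h.mul₁₂]
  simp

theorem mul₂₅ (h : IsHalmosSystem P Q R₁ R₂ R₃ R₄) : R₂ * (P - R₁ - R₂) = 0 := by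
  rw [mul_sub, mul_sub, h.hP.mul_eq_comm h.h₂ h.P₂, h.h₂.isIdempotentElem.eq,
    h.h₁.mul_eq_zero_comm h.h₂ h.mul₁₂]
  simp

theorem mul₃₅ (h : IsHalmosSystem P Q R₁ R₂ R₃ R₄) : R₃ * (P - R₁ - R₂) = 0 := by
  rw [mul_sub, mul_sub, h.hP.mul_eq_zero_comm h.h₃ h.P₃, h.h₁.mul_eq_zero_comm h.h₃ h.mul₁₃,
    h.h₂.mul_eq_zero_comm h.h₃ h.mul₂₃]
  simp

theorem mul₄₅ (h : IsHalmosSystem P Q R₁ R₂ R₃ R₄) : R₄ * (P - R₁ - R₂) = 0 := by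
  rw [mul_sub, mul_sub, h.hP.mul_eq_zero_comm h.h₄ h.P₄, h.h₁.mul_eq_zero_comm h.h₄ h.mul₁₄,
    h.h₂.mul_eq_zero_comm h.h₄ h.mul₂₄]
  simp

theorem mul_five (h : IsHalmosSystem P Q R₁ R₂ R₃ R₄) : P * (P - R₁ - R₂) = P - R₁ - R₂ := by
  rw [mul_sub, mul_sub, h.hP.isIdempotentElem.eq, h.P₁, h.P₂]

theorem five (h : IsHalmosSystem P Q R₁ R₂ R₃ R₄) : IsStarProjection (P - R₁ - R₂) where
  isIdempotentElem := by
    change (P - R₁ - R₂) * (P - R₁ - R₂) = _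
    rw [sub_mul, sub_mul, h.mul₁₅, h.mul₂₅, h.mul_five, sub_zero, sub_zero]
  isSelfAdjoint := (h.hP.isSelfAdjoint.sub h.h₁.isSelfAdjoint).sub h.h₂.isSelfAdjoint

theorem mul₅₆ (h : IsHalmosSystem P Q R₁ R₂ R₃ R₄) :
    (P - R₁ - R₂) * ((1 - P) - R₃ - R₄) = 0 := by
  rw [← h.hP.mul_eq_comm h.five h.mul_five, ← h.swap.mul_five, mul_assoc, ← mul_assoc P,
    mul_sub P, mul_one, h.hP.isIdempotentElem.eq, sub_self, zero_mul, mul_zero]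

/-- The six projections are mutually orthogonal. -/
theorem mul_eq_zero_of_ne (h : IsHalmosSystem P Q R₁ R₂ R₃ R₄) (i j : Fin 6) (hij : i ≠ j) :
    (![R₁, R₂, R₃, R₄, P - R₁ - R₂, (1 - P) - R₃ - R₄] : Fin 6 → R) i *
      (![R₁, R₂, R₃, R₄, P - R₁ - R₂, (1 - P) - R₃ - R₄] : Fin 6 → R) j = 0 := by
  have hp : ∀ i, IsStarProjection
      ((![R₁, R₂, R₃, R₄, P - R₁ - R₂, (1 - P) - R₃ - R₄] : Fin 6 → R) i) := by
    intro i
    fin_cases i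
    exacts [h.h₁, h.h₂, h.h₃, h.h₄, h.five, h.swap.five]
  wlog hlt : i < j generalizing i j
  · exact (hp j).mul_eq_zero_comm (hp i) (this j i hij.symm (hij.lt_or_gt.resolve_left hlt))
  have h' := h.swap
  fin_cases i <;> fin_cases j <;> first | exact absurd hlt (by decide) | skip
  exacts [h.mul₁₂, h.mul₁₃, h.mul₁₄, h.mul₁₅, h'.mul₃₅, h.mul₂₃, h.mul₂₄, h.mul₂₅, h'.mul₄₅,
    h'.mul₁₂, h.mul₃₅, h'.mul₁₅, h.mul₄₅, h'.mul₂₅, h.mul₅₆]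

/-- The projection `R₅ + R₆` onto the generic part commutes with `P`. -/
theorem commute_generic_left (h : IsHalmosSystem P Q R₁ R₂ R₃ R₄) :
    Commute ((P - R₁ - R₂) + ((1 - P) - R₃ - R₄)) P := by
  have e : (P - R₁ - R₂) + ((1 - P) - R₃ - R₄) = 1 - R₁ - R₂ - R₃ - R₄ := by abel
  rw [e, Commute, SemiconjBy]
  simp only [sub_mul, mul_sub, h.P₁, h.P₂, h.P₃, h.P₄, h.hP.mul_eq_comm h.h₁ h.P₁,
    h.hP.mul_eq_comm h.h₂ h.P₂, h.hP.mul_eq_zero_comm h.h₃ h.P₃,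
    h.hP.mul_eq_zero_comm h.h₄ h.P₄, one_mul, mul_one]

/-- The projection `R₅ + R₆` onto the generic part commutes with `Q`. -/
theorem commute_generic_right (h : IsHalmosSystem P Q R₁ R₂ R₃ R₄) :
    Commute ((P - R₁ - R₂) + ((1 - P) - R₃ - R₄)) Q := by
  have e : (P - R₁ - R₂) + ((1 - P) - R₃ - R₄) = 1 - R₁ - R₂ - R₃ - R₄ := by abel
  rw [e, Commute, SemiconjBy]
  simp only [sub_mul, mul_sub, h.Q₁, h.Q₂, h.Q₃, h.Q₄, h.hQ.mul_eq_comm h.h₁ h.Q₁,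
    h.hQ.mul_eq_comm h.h₃ h.Q₃, h.hQ.mul_eq_zero_comm h.h₂ h.Q₂,
    h.hQ.mul_eq_zero_comm h.h₄ h.Q₄, one_mul, mul_one]

theorem generic_mul_left (h : IsHalmosSystem P Q R₁ R₂ R₃ R₄) :
    ((P - R₁ - R₂) + ((1 - P) - R₃ - R₄)) * P = P - R₁ - R₂ := by
  have h6 : (1 - P - R₃ - R₄) * P = 0 := by
    simp only [sub_mul, one_mul, h.hP.isIdempotentElem.eq, h.hP.mul_eq_zero_comm h.h₃ h.P₃,
      h.hP.mul_eq_zero_comm h.h₄ h.P₄, sub_self]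
  rw [add_mul, h6, add_zero, h.hP.mul_eq_comm h.five h.mul_five]

/-- The idempotency of `Q` in terms of its entries on the generic part. -/
theorem mul_six_mul (h : IsHalmosSystem P Q R₁ R₂ R₃ R₄) :
    Q * ((1 - P) - R₃ - R₄) * Q * (P - R₁ - R₂) =
      Q * (P - R₁ - R₂) * (1 - Q) * (P - R₁ - R₂) := by
  have hc := h.commute_generic_right
  have h5 := h.five.isIdempotentElem.eq
  have h65 := h.five.mul_eq_zero_comm h.swap.five h.mul₅₆
  generalize P - R₁ - R₂ = S at *
  generalize 1 - P - R₃ - R₄ = S' at *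
  have hQ := h.hQ.isIdempotentElem.eq
  calc Q * S' * Q * S = Q * ((S + S') * Q) * S - Q * S * Q * S := by noncomm_ring
    _ = (Q * Q) * (S * S + S' * S) - Q * S * Q * S := by rw [hc.eq]; noncomm_ring
    _ = Q * (S * S) - Q * S * Q * S := by rw [hQ, h65, add_zero]
    _ = Q * S * (1 - Q) * S := by noncomm_ring

end Ring

section Density

variable {P Q R₁ R₂ R₃ R₄ : AdjointableMap A H H}

/-- On the generic part the operators `P + Q`, `2 - P - Q`, `P + 1 - Q` and `1 - P + Q` have dense
range, hence so has their product, which acts on `𝓡(R₅)` as `R₅ Q R₆ Q R₅`. -/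
theorem mem_closure_range (h : IsHalmosSystem P Q R₁ R₂ R₃ R₄)
    (hd : ∀ N : AdjointableMap A H H, N * R₁ = 0 → N * R₂ = 0 → N * R₃ = 0 → N * R₄ = 0 → ∀ x,
      N x ∈ (N * (P + Q)).range.closure ∧
      N x ∈ (N * (P + (1 - Q))).range.closure ∧
      N x ∈ (N * ((1 - P) + Q)).range.closure ∧
      N x ∈ (N * ((1 - P) + (1 - Q))).range.closure) (x : H) :
    (P - R₁ - R₂) x ∈
      ((P - R₁ - R₂) * (Q * ((1 - P) - R₃ - R₄) * Q) * (P - R₁ - R₂)).range.closure := by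
  have h' := h.swap
  have hcP := h.commute_generic_left
  have hcQ := h.commute_generic_right
  have hNP := h.generic_mul_left
  have hNP' : ((P - R₁ - R₂) + ((1 - P) - R₃ - R₄)) * (1 - P) = (1 - P) - R₃ - R₄ := by
    rw [mul_sub, hNP, mul_one, add_sub_cancel_left]
  have hNN : ((P - R₁ - R₂) + ((1 - P) - R₃ - R₄)) * ((P - R₁ - R₂) + ((1 - P) - R₃ - R₄)) =
      (P - R₁ - R₂) + ((1 - P) - R₃ - R₄) := by
    rw [add_mul, mul_add, mul_add, h.five.isIdempotentElem.eq, h.swap.five.isIdempotentElem.eq,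
      h.mul₅₆, h.five.mul_eq_zero_comm h.swap.five h.mul₅₆, add_zero, zero_add]
  have hN := hd ((P - R₁ - R₂) + ((1 - P) - R₃ - R₄))
    (by rw [add_mul, h.h₁.mul_eq_zero_comm h.five h.mul₁₅,
      h.h₁.mul_eq_zero_comm h'.five h'.mul₃₅, add_zero])
    (by rw [add_mul, h.h₂.mul_eq_zero_comm h.five h.mul₂₅,
      h.h₂.mul_eq_zero_comm h'.five h'.mul₄₅, add_zero])
    (by rw [add_mul, h.h₃.mul_eq_zero_comm h.five h.mul₃₅,
      h.h₃.mul_eq_zero_comm h'.five h'.mul₁₅, add_zero])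
    (by rw [add_mul, h.h₄.mul_eq_zero_comm h.five h.mul₄₅,
      h.h₄.mul_eq_zero_comm h'.five h'.mul₂₅, add_zero])
  generalize P - R₁ - R₂ = S at *
  generalize 1 - P - R₃ - R₄ = S' at *
  generalize hNdef : S + S' = N at *
  have hc1 := Commute.one_right N
  have c1 : Commute N (P + Q) := hcP.add_right hcQ
  have c2 : Commute N (P + (1 - Q)) := hcP.add_right (hc1.sub_right hcQ)
  have c3 : Commute N ((1 - P) + (1 - Q)) := (hc1.sub_right hcP).add_right (hc1.sub_right hcQ)
  have hZ := mem_closure_range_mul (c1.mul_right c3)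
    (mem_closure_range_mul c1 (fun x => (hN x).1) (fun x => (hN x).2.2.2))
    (mem_closure_range_mul c2 (fun x => (hN x).2.1) (fun x => (hN x).2.2.1)) x
  have hS : S x = P (N x) := by
    rw [← mul_apply, ← hcP.eq, hNP]
  rw [hS]
  refine map_mem_closure P.toCLM.continuous hZ ?_
  rintro _ ⟨z, rfl⟩
  refine ⟨z, congrArg (fun T : AdjointableMap A H H => T z) (?_ : _ = P * (N * _))⟩
  rw [← mul_assoc P, ← hcP.eq, mul_assoc N,
    mul_four_factors h.hP.isIdempotentElem.eq h.hQ.isIdempotentElem.eq]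
  -- `N` is moved past `P` and `Q` until each of `P`, `1 - P` and `P` has its own factor `N`.
  have e : N * (P * Q * (1 - P) * Q * P) = (N * P) * (Q * (N * (1 - P)) * Q) * (N * P) := by
    have k : ∀ y, N * (P * y) = P * (N * y) := fun y => by
      rw [← mul_assoc, hcP.eq, mul_assoc]
    have k' : ∀ y, N * (Q * y) = Q * (N * y) := fun y => by
      rw [← mul_assoc, hcQ.eq, mul_assoc]
    have kN : ∀ y, N * (N * y) = N * y := fun y => by rw [← mul_assoc, hNN]
    simp only [mul_assoc, mul_sub, sub_mul, mul_one, k, k', kN]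
  rw [e, hNP, hNP']

end Density

end IsHalmosSystem

/-- For harmonious projections the four intersections are ranges of projections, and each of the
four sums has dense range relative to any operator that vanishes on these intersections. -/
theorem IsHarmonious.exists_isHalmosSystem {P Q : AdjointableMap A H H} (h : P.IsHarmonious Q) :
    ∃ R₁ R₂ R₃ R₄ : AdjointableMap A H H, IsHalmosSystem P Q R₁ R₂ R₃ R₄ ∧
      R₁.IsProjectionOnto (P.range ⊓ Q.range) ∧ R₂.IsProjectionOnto (P.range ⊓ Q.ker) ∧
      R₃.IsProjectionOnto (P.ker ⊓ Q.range) ∧ R₄.IsProjectionOnto (P.ker ⊓ Q.ker) ∧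
      ∀ N : AdjointableMap A H H, N * R₁ = 0 → N * R₂ = 0 → N * R₃ = 0 → N * R₄ = 0 → ∀ x,
        N x ∈ (N * (P + Q)).range.closure ∧
        N x ∈ (N * (P + (1 - Q))).range.closure ∧
        N x ∈ (N * ((1 - P) + Q)).range.closure ∧
        N x ∈ (N * ((1 - P) + (1 - Q))).range.closure := by
  obtain ⟨hP, hQ, h₄, h₃, h₂, h₁⟩ := h
  obtain ⟨R₁, hR₁, hd₁⟩ := hP.one_sub.exists_isProjectionOnto_ker_inf_ker hQ.one_sub h₁
  obtain ⟨R₂, hR₂, hd₂⟩ := hP.one_sub.exists_isProjectionOnto_ker_inf_ker hQ h₂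
  obtain ⟨R₃, hR₃, hd₃⟩ := hP.exists_isProjectionOnto_ker_inf_ker hQ.one_sub h₃
  obtain ⟨R₄, hR₄, hd₄⟩ := hP.exists_isProjectionOnto_ker_inf_ker hQ h₄
  rw [hP.ker_one_sub] at hR₁ hR₂
  rw [hQ.ker_one_sub] at hR₁ hR₃
  have m₁ : ∀ x ∈ R₁.range, x ∈ P.range ⊓ Q.range := fun x hx => hR₁.2 ▸ hx
  have m₂ : ∀ x ∈ R₂.range, x ∈ P.range ⊓ Q.ker := fun x hx => hR₂.2 ▸ hx
  have m₃ : ∀ x ∈ R₃.range, x ∈ P.ker ⊓ Q.range := fun x hx => hR₃.2 ▸ hx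
  have m₄ : ∀ x ∈ R₄.range, x ∈ P.ker ⊓ Q.ker := fun x hx => hR₄.2 ▸ hx
  refine ⟨R₁, R₂, R₃, R₄, ?_, hR₁, hR₂, hR₃, hR₄, fun N n₁ n₂ n₃ n₄ x =>
    ⟨hd₄ N n₄ x, hd₃ N n₃ x, hd₂ N n₂ x, hd₁ N n₁ x⟩⟩
  exact
    { hP := isProjection_iff.mp hP
      hQ := isProjection_iff.mp hQ
      h₁ := isProjection_iff.mp hR₁.1
      h₂ := isProjection_iff.mp hR₂.1
      h₃ := isProjection_iff.mp hR₃.1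
      h₄ := isProjection_iff.mp hR₄.1
      P₁ := hP.mul_eq_right fun x hx => (m₁ x hx).1
      P₂ := hP.mul_eq_right fun x hx => (m₂ x hx).1
      P₃ := mul_eq_zero_of_range_le_ker fun x hx => (m₃ x hx).1
      P₄ := mul_eq_zero_of_range_le_ker fun x hx => (m₄ x hx).1
      Q₁ := hQ.mul_eq_right fun x hx => (m₁ x hx).2
      Q₂ := mul_eq_zero_of_range_le_ker fun x hx => (m₂ x hx).2
      Q₃ := hQ.mul_eq_right fun x hx => (m₃ x hx).2
      Q₄ := mul_eq_zero_of_range_le_ker fun x hx => (m₄ x hx).2 }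

theorem apply_eq_of_mul_eq {E : Type*} [NormedAddCommGroup E] [NormedSpace ℂ E] [SMul A E]
    [CStarModule A E] {S T R : AdjointableMap A E E} (h : S * R = T * R) {x : E}
    (hx : x ∈ R.range) : S x = T x := by
  obtain ⟨y, rfl⟩ := hx
  exact congrArg (fun T : AdjointableMap A E E => T y) h

end TwoProjections

end AdjointableMap

end HilbertCStar

theorem mainTheorem2 {A H : Type*} [NonUnitalCStarAlgebra A] [PartialOrder A] [StarOrderedRing A]
    [NormedAddCommGroup H] [NormedSpace ℂ H] [CompleteSpace H] [SMul A H] [CStarModule A H]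
    (P Q : AdjointableMap A H H) (hPQ : P.IsHarmonious Q) :
    ∃ (P₁ P₂ P₃ P₄ P₅ P₆ : AdjointableMap A H H)
      (h₅ : P₅.IsProjection) (h₆ : P₆.IsProjection),
      -- the projections onto the six submodules
      P₁.IsProjectionOnto (P.range ⊓ Q.range) ∧
      P₂.IsProjectionOnto (P.range ⊓ Q.ker) ∧
      P₃.IsProjectionOnto (P.ker ⊓ Q.range) ∧
      P₄.IsProjectionOnto (P.ker ⊓ Q.ker) ∧
      P₅ = P - P₁ - P₂ ∧
      P₆ = (1 - P) - P₃ - P₄ ∧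
      -- the orthogonal splitting of `H`
      CStarSubmodule.IsOrthogonalDecomposition
        ![P₁.range, P₂.range, P₃.range, P₄.range, P₅.range, P₆.range] ∧
      ∃ (Q₀ : AdjointableMap A P₅.range P₅.range) (B : AdjointableMap A P₆.range P₅.range)
        (T : AdjointableMap A C⋆ᵐᵒᵈ(A, P₅.range × P₆.range) C⋆ᵐᵒᵈ(A, P₅.range × P₆.range)),
        -- the compressions of `Q` to the generic part
        Q₀ = compress h₅ h₅ Q ∧
        B = compress h₅ h₆ Q ∧
        T = block Q₀ B B.adjoint (compress h₆ h₆ Q) ∧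
        -- `P = I ⊕ I ⊕ 0 ⊕ 0 ⊕ I ⊕ 0` and `Q = I ⊕ 0 ⊕ I ⊕ 0 ⊕ T`
        (∀ x₁ ∈ P₁.range, ∀ x₂ ∈ P₂.range, ∀ x₃ ∈ P₃.range, ∀ x₄ ∈ P₄.range,
          ∀ (x₅ : P₅.range) (x₆ : P₆.range),
            P (x₁ + x₂ + x₃ + x₄ + x₅ + x₆) = x₁ + x₂ + x₅ ∧
            Q (x₁ + x₂ + x₃ + x₄ + x₅ + x₆) =
              x₁ + x₃ + (T ((WithCStarModule.equiv A _).symm (x₅, x₆))).1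
                + (T ((WithCStarModule.equiv A _).symm (x₅, x₆))).2) ∧
        -- the operators `Q₀` and `I - Q₀`
        Q₀.IsPositive ∧ Function.Injective Q₀.toCLM ∧ ‖Q₀.toCLM‖ ≤ 1 ∧
        (1 - Q₀).IsPositive ∧ Function.Injective (1 - Q₀).toCLM ∧ ‖(1 - Q₀).toCLM‖ ≤ 1 ∧
        -- the block form of `T`, where `C = Q₀^{1/2}` and `D = (I - Q₀)^{1/2}`
        ∃ (U₀ : AdjointableMap A P₆.range P₅.range) (C D : AdjointableMap A P₅.range P₅.range),
          U₀.IsUnitary ∧ C.IsPositiveSqrt Q₀ ∧ D.IsPositiveSqrt (1 - Q₀) ∧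
          T = block Q₀ ((C.comp D).comp U₀) (U₀.adjoint.comp (C.comp D))
                (U₀.adjoint.comp ((1 - Q₀).comp U₀)) := by
  obtain ⟨R₁, R₂, R₃, R₄, hs, hR₁, hR₂, hR₃, hR₄, hd⟩ := hPQ.exists_isHalmosSystem
  have hP : P.IsProjection := hPQ.1
  have hQ : Q.IsProjection := hPQ.2.1
  have hs' := hs.swap
  have h₅ := isProjection_iff.mpr hs.five
  have h₆ := isProjection_iff.mpr hs'.five
  have hden₅ := hs.mem_closure_range hd
  have hden₆ := hs'.mem_closure_range fun N n₁ n₂ n₃ n₄ x => by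
    have := hd N n₃ n₄ n₁ n₂ x
    rw [sub_sub_cancel]
    exact ⟨this.2.2.1, this.2.2.2, this.1, this.2.1⟩
  rw [sub_sub_cancel] at hden₆
  have hQsix := hs.mul_six_mul
  have hcQ := hs.commute_generic_right
  have hP₅ : P * (P - R₁ - R₂) = 1 * (P - R₁ - R₂) := by rw [hs.mul_five, one_mul]
  have hP₆ : P * ((1 - P) - R₃ - R₄) = 0 * ((1 - P) - R₃ - R₄) := by
    rw [mul_sub, mul_sub, mul_sub, mul_one, hs.hP.isIdempotentElem.eq, hs.P₃, hs.P₄, sub_self,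
      sub_zero, sub_zero, zero_mul]
  have hN₅ : ((P - R₁ - R₂) + ((1 - P) - R₃ - R₄)) * (P - R₁ - R₂) = 1 * (P - R₁ - R₂) := by
    rw [add_mul, hs.five.isIdempotentElem.eq, hs.five.mul_eq_zero_comm hs'.five hs.mul₅₆,
      add_zero, one_mul]
  have hN₆ : ((P - R₁ - R₂) + ((1 - P) - R₃ - R₄)) * ((1 - P) - R₃ - R₄) =
      1 * ((1 - P) - R₃ - R₄) := by
    rw [add_mul, hs'.five.isIdempotentElem.eq, hs.mul₅₆, zero_add, one_mul]
  have hdec : CStarSubmodule.IsOrthogonalDecomposition ![R₁.range, R₂.range, R₃.range, R₄.range,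
      (P - R₁ - R₂).range, ((1 - P) - R₃ - R₄).range] := by
    have := IsProjection.isOrthogonalDecomposition
      (R := ![R₁, R₂, R₃, R₄, P - R₁ - R₂, (1 - P) - R₃ - R₄])
      (fun i => by
        fin_cases i
        exacts [hR₁.1, hR₂.1, hR₃.1, hR₄.1, h₅, h₆])
      hs.mul_eq_zero_of_ne (by simp only [Fin.sum_univ_six, Matrix.cons_val]; abel)
    convert this using 1
    ext1 i
    fin_cases i <;> rfl
  have hz₁ : ∀ x ∈ (P - R₁ - R₂).range, x ∈ Q.ker → x = 0 := fun x hx hxQ => by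
    have hx₂ : x ∈ R₂.range := by
      rw [hR₂.2]
      exact ⟨hP.mem_range_iff.mpr (apply_eq_of_mul_eq hP₅ hx), hxQ⟩
    exact CStarModule.inner_self.mp (hdec.1 1 4 (by decide) x hx₂ x hx)
  have hz₂ : ∀ x ∈ (P - R₁ - R₂).range, x ∈ (1 - Q).ker → x = 0 := fun x hx hxQ => by
    have hx₁ : x ∈ R₁.range := by
      rw [hR₁.2, ← hQ.ker_one_sub]
      exact ⟨hP.mem_range_iff.mpr (apply_eq_of_mul_eq hP₅ hx), hxQ⟩
    exact CStarModule.inner_self.mp (hdec.1 0 4 (by decide) x hx₁ x hx)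
  refine ⟨R₁, R₂, R₃, R₄, P - R₁ - R₂, (1 - P) - R₃ - R₄, h₅, h₆, hR₁, hR₂, hR₃, hR₄, rfl, rfl,
    hdec, compress h₅ h₅ Q, compress h₅ h₆ Q, _, rfl, rfl, rfl, ?_, isPositive_compress h₅ hQ,
    injective_compress h₅ hQ hz₁, norm_compress_le h₅ hQ, ?_, ?_, ?_, ?_⟩
  · have hadj := adjoint_compress h₅ h₆ hs.hQ.isSelfAdjoint
    rw [hadj]
    intro x₁ hx₁ x₂ hx₂ x₃ hx₃ x₄ hx₄ x₅ x₆
    have eP : P x₁ = x₁ ∧ P x₂ = x₂ ∧ P x₃ = 0 ∧ P x₄ = 0 :=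
      ⟨apply_eq_of_mul_eq (T := 1) hs.P₁ hx₁, apply_eq_of_mul_eq (T := 1) hs.P₂ hx₂,
        apply_eq_of_mul_eq (T := 0) (by rw [hs.P₃, zero_mul]) hx₃,
        apply_eq_of_mul_eq (T := 0) (by rw [hs.P₄, zero_mul]) hx₄⟩
    have eQ : Q x₁ = x₁ ∧ Q x₂ = 0 ∧ Q x₃ = x₃ ∧ Q x₄ = 0 :=
      ⟨apply_eq_of_mul_eq (T := 1) hs.Q₁ hx₁,
        apply_eq_of_mul_eq (T := 0) (by rw [hs.Q₂, zero_mul]) hx₂,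
        apply_eq_of_mul_eq (T := 1) hs.Q₃ hx₃,
        apply_eq_of_mul_eq (T := 0) (by rw [hs.Q₄, zero_mul]) hx₄⟩
    have eP₅ : P x₅ = x₅ := apply_eq_of_mul_eq hP₅ x₅.2
    have eP₆ : P x₆ = 0 := apply_eq_of_mul_eq hP₆ x₆.2
    refine ⟨?_, ?_⟩
    · simp only [map_add, eP, eP₅, eP₆, add_zero]
    · change _ = x₁ + x₃ + ((compress h₅ h₅ Q x₅ : H) + (compress h₅ h₆ Q x₆ : H)) +
        ((compress h₆ h₅ Q x₅ : H) + (compress h₆ h₆ Q x₆ : H))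
      simp only [coe_compress_apply]
      have e : ∀ x : H, (P - R₁ - R₂) (Q x) + ((1 - P) - R₃ - R₄) (Q x) =
          Q (((P - R₁ - R₂) + ((1 - P) - R₃ - R₄)) x) := fun x =>
        congrArg (fun T : AdjointableMap A H H => T x) hcQ.eq
      have e₅ := e x₅
      have e₆ := e x₆
      rw [apply_eq_of_mul_eq hN₅ x₅.2, one_apply] at e₅
      rw [apply_eq_of_mul_eq hN₆ x₆.2, one_apply] at e₆
      simp only [map_add, eQ]
      generalize (P - R₁ - R₂) (Q x₅) = a, ((1 - P) - R₃ - R₄) (Q x₅) = b,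
        (P - R₁ - R₂) (Q x₆) = c, ((1 - P) - R₃ - R₄) (Q x₆) = d at e₅ e₆ ⊢
      rw [← e₅, ← e₆]
      abel
  · rw [one_sub_compress]
    exact isPositive_compress h₅ hQ.one_sub
  · rw [one_sub_compress]
    exact injective_compress h₅ hQ.one_sub hz₂
  · rw [one_sub_compress]
    exact norm_compress_le h₅ hQ.one_sub
  · have := h₅.completeSpace_range
    have := h₆.completeSpace_range
    have hadj := adjoint_compress h₅ h₆ hs.hQ.isSelfAdjoint
    have hBB : (compress h₅ h₆ Q).comp (compress h₅ h₆ Q).adjoint =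
        compress h₅ h₅ (Q * ((1 - P) - R₃ - R₄) * Q) := by
      rw [hadj]
      refine ext fun x => Subtype.ext ?_
      change (compress h₅ h₆ Q (compress h₆ h₅ Q x) : H) = _
      simp only [coe_compress_apply]
      rfl
    -- both relations come from applying `hQsix` to a vector of the range of `R₅`
    have hx : ∀ x : (P - R₁ - R₂).range, Q (((1 - P) - R₃ - R₄) (Q x)) =
        Q ((P - R₁ - R₂) ((1 - Q) x)) := fun x => apply_eq_of_mul_eq hQsix x.2
    obtain ⟨U, C, D, hU, hC, hD, e₁, e₂, e₃⟩ := exists_halmos_unitary (S := compress h₅ h₅ Q)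
      (B := compress h₅ h₆ Q) (K := compress h₆ h₆ Q) (isPositive_compress h₅ hQ)
      (by rw [one_sub_compress]; exact isPositive_compress h₅ hQ.one_sub)
      (by
        rw [hadj, one_sub_compress]
        refine ext fun x => Subtype.ext ?_
        change (compress h₅ h₆ Q (compress h₆ h₅ Q x) : H) =
          compress h₅ h₅ Q (compress h₅ h₅ (1 - Q) x)
        simp only [coe_compress_apply, hx])
      (by
        rw [hadj, one_sub_compress]
        refine ext fun x => Subtype.ext ?_
        change (compress h₆ h₆ Q (compress h₆ h₅ Q x) : H) =
          compress h₆ h₅ Q (compress h₅ h₅ (1 - Q) x)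
        simp only [coe_compress_apply, hx])
      (by rw [hBB]; exact denseRange_compress h₅ h₅ hden₅)
      (by
        rw [hadj]
        refine denseRange_compress h₆ h₅ fun x => closure_mono ?_ (hden₆ x)
        rintro _ ⟨w, rfl⟩
        exact ⟨Q (((1 - P) - R₃ - R₄) w), rfl⟩)
    refine ⟨U, C, D, hU, hC, hD, ?_⟩
    rw [← e₁, ← e₂, ← e₃]
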